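/- Let $\lambda=(\lambda_n)_{n\ge 1}$ be a frequency, i.e. a strictly increasing sequence of non-negative real numbers tending to $+\infty$. Let $\mathcal D_\infty(\lambda)$ be the space of all formal Dirichlet series $D=\sum_n a_n e^{-\lambda_n s}$ with complex coefficients $a_n$ which converge at every point of $[\mathrm{Re}>0]=\{s\in\mathbf C:\mathrm{Re}\,s>0\}$ and whose limit function is bounded there, with $\|D\|_\infty=\sup_{\mathrm{Re}\,s>0}|D(s)|$. Assume that at least one of the following holds: (i) $\lambda$ satisfies Landau's condition (LC): for every $\delta>0$ there is $C>0$ such that $\lambda_{n+1}-\lambda_n\ge C e^{-e^{\delta\lambda_n}}$ for all $n$; (ii) $L(\lambda):=\limsup_{N\to\infty}\frac{\log N}{\lambda_N}=0$; (iii) $\lambda$ is linearly independent over $\mathbf Q$. Let $(D_j)$ be a sequence in $\mathcal D_\infty(\lambda)$, $D_j=\sum_n a_n^j e^{-\lambda_n s}$, with $\sup_j\|D_j\|_\infty<\infty$. Then there is a strictly increasing sequence $(j_k)$ of indices such that the limits $a_n:=\lim_{k\to\infty}a_n^{j_k}$ exist for all $n$, the series $D=\sum_n a_n e^{-\lambda_n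 s}$ belongs to $\mathcal D_\infty(\lambda)$, and for every $\varepsilon>0$ the functions $D_{j_k}$ converge to $D$ uniformly on $[\mathrm{Re}>\varepsilon]$ as $k\to\infty$. -/

import Mathlib

open Filter Topology

noncomputable section

namespace GenDirichlet

/-- A frequency: a strictly increasing, non-negative real sequence tending to `+∞`.
Sequences are indexed from `0`, so `lam n` is the `(n+1)`-st frequency. -/
structure IsFrequency (lam : ℕ → ℝ) : Prop where
  strictMono : StrictMono lam
  nonneg : ∀ n, 0 ≤ lam n
  tendsto : Tendsto lam atTop atTop

/-- Landau's condition. -/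
def LandauCondition (lam : ℕ → ℝ) : Prop :=
  ∀ δ : ℝ, 0 < δ → ∃ C : ℝ, 0 < C ∧
    ∀ n : ℕ, C * Real.exp (-Real.exp (δ * lam n)) ≤ lam (n + 1) - lam n

/-- `L(lam) = limsup log N / lam_N`, in the extended reals. As sequences are indexed from `0`,
the entry with position `N = n + 1` is `lam n`. -/
def bohrL (lam : ℕ → ℝ) : EReal :=
  limsup (fun n : ℕ => ((Real.log ((n : ℝ) + 1) / lam n : ℝ) : EReal)) atTop

/-- The open half plane `[Re > σ]`. -/
def halfPlane (σ : ℝ) : Set ℂ := {s : ℂ | σ < s.re}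

/-- The sum of the first `N` terms, at `s`, of the formal Dirichlet series with frequency `lam`
and coefficients `a`. A formal `lam`-Dirichlet series is identified with its coefficients. -/
def partialSum (lam : ℕ → ℝ) (a : ℕ → ℂ) (N : ℕ) (s : ℂ) : ℂ :=
  ∑ n ∈ Finset.range N, a n * Complex.exp (-(lam n : ℂ) * s)

/-- Convergence (not necessarily absolute) of the series at `s`. -/
def ConvergesAt (lam : ℕ → ℝ) (a : ℕ → ℂ) (s : ℂ) : Prop :=
  ∃ z : ℂ, Tendsto (fun N => partialSum lam a N s) atTop (𝓝 z)

/-- The limit function of the series; meaningful where the series converges. -/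
def limitFun (lam : ℕ → ℝ) (a : ℕ → ℂ) (s : ℂ) : ℂ :=
  limUnder atTop (fun N => partialSum lam a N s)

/-- The space `D_∞(lam)`: all `lam`-Dirichlet series which converge on `[Re > 0]` and define a
bounded function there. -/
def DInfty (lam : ℕ → ℝ) : Set (ℕ → ℂ) :=
  {a | (∀ s ∈ halfPlane 0, ConvergesAt lam a s) ∧
    BddAbove ((fun s => ‖limitFun lam a s‖) '' halfPlane 0)}

/-- The norm of `D_∞(lam)`: the supremum of the modulus of the limit function on `[Re > 0]`. -/
def supNorm (lam : ℕ → ℝ) (a : ℕ → ℂ) : ℝ :=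
  sSup ((fun s => ‖limitFun lam a s‖) '' halfPlane 0)

end GenDirichlet

end

/-! Everything reduces to `UniformTails`: on `[Re > ε]` the series of a ball of `D_∞(lam)` converge
uniformly at a common rate. The coefficients of the ball are bounded, so compactness of a product of
discs gives a coefficientwise convergent subsequence. A fixed partial sum then converges uniformly,
since each exponential has modulus at most one, and the tails are uniformly small
(`UniformTails.exists_subseq`).

The tails rest on one estimate, `exists_multiplier_bound`: inserting the factors `φ ((lam n - b) /
h)` amounts to integrating the limit function along a vertical line against the Fourier transform of
`φ`. This costs only the L¹ norm of that transform, whatever `b`, `h` and the frequency. If `L(lam)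
= 0`, isolating one frequency bounds each coefficient, and `∑ exp (-ε lam n)` converges. Under
Landau's condition, a sharp cut-off is a smooth one narrower than the gap, split into dyadic pieces;
their number is logarithmic in the gap, so partial sums are `O(exp (δ lam N))` and Abel summation
applies. For independent frequencies, a Riesz product bounds the sum of the `‖a n‖`. -/

open MeasureTheory FourierTransform

namespace GenDirichlet

/-! ### Abel summation and growth on vertical lines -/

/-- Summation by parts. -/
theorem sum_range_mul_eq_by_parts (b v : ℕ → ℂ) (N : ℕ) :
    ∑ n ∈ Finset.range N, b n * v n = (∑ n ∈ Finset.range N, b n) * v N +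
      ∑ n ∈ Finset.range N, (∑ m ∈ Finset.range (n + 1), b m) * (v n - v (n + 1)) := by
  induction N with
  | zero => simp
  | succ N ih =>
    rw [Finset.sum_range_succ, ih, Finset.sum_range_succ (fun n => (∑ m ∈ Finset.range (n + 1), b m) *
      (v n - v (n + 1))), Finset.sum_range_succ b]
    ring

theorem partialSum_add (lam : ℕ → ℝ) (a : ℕ → ℂ) (N : ℕ) (s w : ℂ) :
    partialSum lam a N (s + w) = ∑ n ∈ Finset.range N,
      a n * Complex.exp (-(lam n : ℂ) * s) * Complex.exp (-(lam n : ℂ) * w) := by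
  refine Finset.sum_congr rfl fun n _ => ?_
  rw [mul_assoc, ← Complex.exp_add]
  ring_nf

theorem norm_exp_neg_ofReal_mul (x : ℝ) (s : ℂ) :
    ‖Complex.exp (-(x : ℂ) * s)‖ = Real.exp (-x * s.re) := by
  rw [Complex.norm_exp]
  simp

theorem norm_exp_neg_ofReal_mul_le_one {x : ℝ} (hx : 0 ≤ x) {s : ℂ} (hs : 0 ≤ s.re) :
    ‖Complex.exp (-(x : ℂ) * s)‖ ≤ 1 := by
  rw [norm_exp_neg_ofReal_mul, Real.exp_le_one_iff]
  nlinarith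

/-- The difference is `w` times the integral of `exp (-w u)` over `[x, y]`. The real exponentials on
the right telescope in Abel summation. -/
theorem norm_exp_sub_exp_le {w : ℂ} (hw : 0 < w.re) {x y : ℝ} (hxy : x ≤ y) :
    ‖Complex.exp (-(x : ℂ) * w) - Complex.exp (-(y : ℂ) * w)‖ ≤
      ‖w‖ / w.re * (Real.exp (-x * w.re) - Real.exp (-y * w.re)) := by
  have hw0 : w ≠ 0 := by rintro rfl; simp at hw
  have h1 := integral_exp_mul_complex (a := x) (b := y) (neg_ne_zero.2 hw0)
  have h2 : ∫ u in x..y, Real.exp (-w.re * u) =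
      (Real.exp (-x * w.re) - Real.exp (-y * w.re)) / w.re := by
    rw [intervalIntegral.integral_comp_mul_left (fun u => Real.exp u) (neg_ne_zero.2 hw.ne'),
      integral_exp, smul_eq_mul]
    field_simp
    ring_nf
  have h3 : Complex.exp (-(x : ℂ) * w) - Complex.exp (-(y : ℂ) * w) =
      w * ∫ u in x..y, Complex.exp (-w * u) := by
    rw [h1]
    field_simp
    ring_nf
  rw [h3, norm_mul, div_mul_eq_mul_div, mul_div_assoc, ← h2]
  refine mul_le_mul_of_nonneg_left ?_ (norm_nonneg _)
  refine (intervalIntegral.norm_integral_le_integral_norm hxy).trans (le_of_eq ?_)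
  refine intervalIntegral.integral_congr fun u _ => ?_
  simp [Complex.norm_exp]

/-- On a vertical line to the right of a point of convergence, the partial sums grow at most
linearly, uniformly in their length. -/
theorem exists_norm_partialSum_le {lam : ℕ → ℝ} (hlam : IsFrequency lam) {a : ℕ → ℂ}
    (ha : ∀ s ∈ halfPlane 0, ConvergesAt lam a s) {s : ℂ} (hs : 0 < s.re) :
    ∃ K : ℝ, ∀ (N : ℕ) (t : ℝ),
      ‖partialSum lam a N (s + t * Complex.I)‖ ≤ K * (1 + |t|) := by
  -- At `r` the series converges, so its partial sums are bounded; Abel summation carries this to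
  -- the line through `s`, at distance `r` to the right.
  set r : ℝ := s.re / 2 with hr
  have hr0 : 0 < r := by positivity
  obtain ⟨z, hz⟩ := ha (r : ℂ) (by simpa [halfPlane] using hr0)
  obtain ⟨K, hK⟩ := (Metric.isBounded_range_of_tendsto _ hz).exists_norm_le
  replace hK : ∀ N, ‖partialSum lam a N (r : ℂ)‖ ≤ K := fun N => hK _ ⟨N, rfl⟩
  have hK0 : 0 ≤ K := (norm_nonneg _).trans (hK 0)
  refine ⟨K * (1 + (‖s - r‖ + 1) / r), fun N t => ?_⟩
  set w : ℂ := s + t * Complex.I - r with hw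
  have hwre : w.re = r := by simp [hw, hr]; ring
  have hwn : ‖w‖ ≤ ‖s - r‖ + |t| := by
    have : w = (s - r) + t * Complex.I := by rw [hw]; ring
    rw [this]
    refine (norm_add_le _ _).trans (by simp)
  have hexp : ∀ n, Real.exp (-lam n * r) ≤ 1 := fun n =>
    Real.exp_le_one_iff.2 (by nlinarith [hlam.nonneg n])
  have key : ‖partialSum lam a N (s + t * Complex.I)‖ ≤ K * 1 + K * (‖w‖ / r) := by
    have : s + t * Complex.I = (r : ℂ) + w := by rw [hw]; ring
    rw [this, partialSum_add, sum_range_mul_eq_by_parts]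
    refine (norm_add_le _ _).trans (add_le_add ?_ ?_)
    · rw [norm_mul]
      exact mul_le_mul (hK N) (norm_exp_neg_ofReal_mul_le_one (hlam.nonneg N)
        (by rw [hwre]; exact hr0.le)) (norm_nonneg _) hK0
    · calc _ ≤ ∑ n ∈ Finset.range N, K * (‖w‖ / r *
            (Real.exp (-lam n * r) - Real.exp (-lam (n + 1) * r))) := by
            refine norm_sum_le_of_le _ fun n _ => ?_
            rw [norm_mul]
            refine mul_le_mul (hK (n + 1)) ?_ (norm_nonneg _) hK0
            have := norm_exp_sub_exp_le (w := w) (by rw [hwre]; exact hr0)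
              (hlam.strictMono.monotone (Nat.le_succ n))
            rwa [hwre] at this
        _ = K * (‖w‖ / r * (Real.exp (-lam 0 * r) - Real.exp (-lam N * r))) := by
            rw [← Finset.mul_sum, ← Finset.mul_sum, Finset.sum_range_sub']
        _ ≤ K * (‖w‖ / r) := by
            refine mul_le_mul_of_nonneg_left ?_ hK0
            refine mul_le_of_le_one_right (by positivity) ?_
            linarith [hexp 0, Real.exp_pos (-lam N * r)]
  refine key.trans ?_
  rw [← mul_add, mul_assoc]
  refine mul_le_mul_of_nonneg_left ?_ hK0
  have h1 : ‖w‖ / r ≤ (‖s - r‖ + 1) / r * (1 + |t|) := by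
    rw [div_mul_eq_mul_div]
    gcongr
    nlinarith [norm_nonneg (s - r), abs_nonneg t]
  nlinarith [abs_nonneg t]

theorem tendsto_limitFun {lam : ℕ → ℝ} {a : ℕ → ℂ} {s : ℂ} (h : ConvergesAt lam a s) :
    Tendsto (fun N => partialSum lam a N s) atTop (𝓝 (limitFun lam a s)) :=
  tendsto_nhds_limUnder h

theorem norm_limitFun_le {lam : ℕ → ℝ} {a : ℕ → ℂ} (ha : a ∈ DInfty lam) {M : ℝ}
    (hM : supNorm lam a ≤ M) {s : ℂ} (hs : s ∈ halfPlane 0) : ‖limitFun lam a s‖ ≤ M :=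
  (le_csSup ha.2 ⟨s, hs, rfl⟩).trans hM

/-! ### Smooth multipliers -/

/-- Smooth multipliers act boundedly on `D_∞(lam)`, with a constant which is invariant under
affine changes of the variable and does not depend on the frequency. -/
theorem exists_multiplier_bound {φ : ℝ → ℂ} (hc : HasCompactSupport φ)
    (hφ : ContDiff ℝ (⊤ : ℕ∞) φ) :
    ∃ C : ℝ, 0 ≤ C ∧ ∀ lam : ℕ → ℝ, IsFrequency lam → ∀ a ∈ DInfty lam, ∀ M : ℝ,
      supNorm lam a ≤ M → ∀ b h : ℝ, 0 < h → ∀ s : ℂ, 0 < s.re → ∀ N : ℕ,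
      (∀ n, N ≤ n → φ ((lam n - b) / h) = 0) →
      ‖∑ n ∈ Finset.range N, a n * Complex.exp (-(lam n : ℂ) * s) * φ ((lam n - b) / h)‖
        ≤ C * M := by
  set f : SchwartzMap ℝ ℂ := hc.toSchwartzMap hφ with hf
  set ψ : SchwartzMap ℝ ℂ := 𝓕 f with hψ
  have hinv : ∀ x : ℝ, φ x = ∫ τ : ℝ, Complex.exp ((2 * Real.pi * (τ * x) : ℝ) * Complex.I) * ψ τ := by
    intro x
    have h1 : 𝓕⁻ ψ = f := by rw [hψ]; simp
    have h2 : f x = 𝓕⁻ (ψ : ℝ → ℂ) x := by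
      rw [← SchwartzMap.fourierInv_coe, h1]
    have h3 : f x = φ x := rfl
    rw [← h3, h2, Real.fourierInv_eq']
    simp [mul_comm]
  refine ⟨∫ τ, ‖ψ τ‖, integral_nonneg fun _ => norm_nonneg _, ?_⟩
  intro lam hlam a ha M hM b h hh s hs N hN
  obtain ⟨K, hK⟩ := exists_norm_partialSum_le hlam ha.1 hs
  -- In Fourier inversion, scaling by `h` becomes the height of `p τ`, and translation by `b` the
  -- unimodular factor `e τ`.
  set p : ℝ → ℂ := fun τ => s + ((-(2 * Real.pi * τ / h) : ℝ) : ℂ) * Complex.I with hp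
  set e : ℝ → ℂ := fun τ => Complex.exp (((-(2 * Real.pi * (τ * (b / h))) : ℝ) : ℂ) * Complex.I)
    with he
  have hen : ∀ τ, ‖e τ‖ = 1 := fun τ => Complex.norm_exp_ofReal_mul_I _
  set G : ℕ → ℝ → ℂ := fun m τ => e τ * partialSum lam a m (p τ) * ψ τ with hG
  have hpc : Continuous p := by fun_prop
  have hec : Continuous e := by fun_prop
  have hGc : ∀ m, Continuous (G m) := by
    intro m
    simp only [hG, partialSum]
    have := ψ.continuous
    fun_prop
  have hint0 : Integrable (fun τ => ‖ψ τ‖) := ψ.integrable.norm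
  have hint1 : Integrable (fun τ : ℝ => ‖τ‖ ^ 1 * ‖ψ τ‖) := ψ.integrable_pow_mul volume 1
  have hGint : ∀ m, ∫ τ, G m τ = ∑ n ∈ Finset.range m,
      a n * Complex.exp (-(lam n : ℂ) * s) * φ ((lam n - b) / h) := by
    intro m
    have h1 : ∀ τ, G m τ = ∑ n ∈ Finset.range m, a n * Complex.exp (-(lam n : ℂ) * s) *
        (Complex.exp ((2 * Real.pi * (τ * ((lam n - b) / h)) : ℝ) * Complex.I) * ψ τ) := by
      intro τ
      simp only [hG, hp, partialSum_add, Finset.mul_sum, Finset.sum_mul]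
      refine Finset.sum_congr rfl fun n _ => ?_
      have : Complex.exp ((2 * Real.pi * (τ * ((lam n - b) / h)) : ℝ) * Complex.I) =
          e τ * Complex.exp (-(lam n : ℂ) * (((-(2 * Real.pi * τ / h) : ℝ) : ℂ) * Complex.I)) := by
        rw [he, ← Complex.exp_add]
        congr 1
        push_cast
        ring
      rw [this]
      ring
    simp_rw [h1]
    rw [integral_finsetSum]
    · refine Finset.sum_congr rfl fun n _ => ?_
      rw [integral_const_mul, hinv]
    · intro n _
      refine Integrable.const_mul ?_ _
      refine ψ.integrable.bdd_mul (c := 1) (Continuous.aestronglyMeasurable (by fun_prop)) ?_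
      exact Eventually.of_forall fun τ => (Complex.norm_exp_ofReal_mul_I _).le
  have hmem : ∀ τ, p τ ∈ halfPlane 0 := by
    intro τ
    simpa [halfPlane, hp] using hs
  -- Only the limit function is bounded by `M`. The partial sums grow linearly in `τ`, which the
  -- decay of `ψ` absorbs.
  have hlim : Tendsto (fun m => ∫ τ, G m τ) atTop
      (𝓝 (∫ τ, e τ * limitFun lam a (p τ) * ψ τ)) := by
    refine tendsto_integral_of_dominated_convergence
      (fun τ => K * ‖ψ τ‖ + K * (2 * Real.pi / h) * (‖τ‖ ^ 1 * ‖ψ τ‖))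
      (fun m => (hGc m).aestronglyMeasurable)
      ((hint0.const_mul _).add (hint1.const_mul _)) ?_ ?_
    · refine fun m => Eventually.of_forall fun τ => ?_
      simp only [hG, norm_mul, hen, one_mul]
      have h1 := mul_le_mul_of_nonneg_right (hK m (-(2 * Real.pi * τ / h))) (norm_nonneg (ψ τ))
      refine h1.trans (le_of_eq ?_)
      rw [abs_neg, abs_div, abs_mul, abs_of_pos hh, abs_of_pos Real.two_pi_pos, Real.norm_eq_abs]
      ring
    · refine Eventually.of_forall fun τ => ?_
      exact ((tendsto_limitFun (ha.1 _ (hmem τ))).const_mul _).mul_const _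
  have hconst : ∀ᶠ m in atTop, (∫ τ, G m τ) = ∑ n ∈ Finset.range N,
      a n * Complex.exp (-(lam n : ℂ) * s) * φ ((lam n - b) / h) := by
    filter_upwards [eventually_ge_atTop N] with m hm
    rw [hGint]
    symm
    refine Finset.sum_subset (Finset.range_mono hm) fun n _ hn => ?_
    rw [hN n (by simpa using hn), mul_zero]
  rw [tendsto_nhds_unique (tendsto_const_nhds.congr' (hconst.mono fun _ h => h.symm)) hlim,
    ← integral_mul_const]
  refine norm_integral_le_of_norm_le (hint0.mul_const M) (Eventually.of_forall fun τ => ?_)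
  rw [norm_mul, norm_mul, hen, one_mul, mul_comm]
  exact mul_le_mul_of_nonneg_left (norm_limitFun_le ha hM (hmem τ)) (norm_nonneg _)

/-! ### Cut-off functions -/

/-- A smooth function which is `1` on `[-1, 0]` and vanishes outside `[-2, 1]`. -/
noncomputable def plateau (x : ℝ) : ℝ := Real.smoothTransition (x + 2) * Real.smoothTransition (1 - x)

/-- The difference of a smooth downward step on `[0, 1]` and of its dilation by two. -/
noncomputable def stepDiff (x : ℝ) : ℝ :=
  Real.smoothTransition (1 - x) - Real.smoothTransition (1 - x / 2)

theorem plateau_eq_one {x : ℝ} (h₁ : -1 ≤ x) (h₂ : x ≤ 0) : plateau x = 1 := by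
  rw [plateau, Real.smoothTransition.one_of_one_le (by linarith),
    Real.smoothTransition.one_of_one_le (by linarith), one_mul]

theorem plateau_eq_step {x : ℝ} (h : -1 ≤ x) : plateau x = Real.smoothTransition (1 - x) := by
  rw [plateau, Real.smoothTransition.one_of_one_le (by linarith), one_mul]

theorem plateau_eq_zero_of_le {x : ℝ} (h : x ≤ -2) : plateau x = 0 := by
  rw [plateau, Real.smoothTransition.zero_of_nonpos (by linarith), zero_mul]

theorem plateau_eq_zero_of_ge {x : ℝ} (h : 1 ≤ x) : plateau x = 0 := by
  rw [plateau, Real.smoothTransition.zero_of_nonpos (x := 1 - x) (by linarith), mul_zero]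

theorem stepDiff_eq_zero_of_le {x : ℝ} (h : x ≤ 0) : stepDiff x = 0 := by
  rw [stepDiff, Real.smoothTransition.one_of_one_le (by linarith),
    Real.smoothTransition.one_of_one_le (by linarith), sub_self]

theorem stepDiff_eq_zero_of_ge {x : ℝ} (h : 2 ≤ x) : stepDiff x = 0 := by
  rw [stepDiff, Real.smoothTransition.zero_of_nonpos (by linarith),
    Real.smoothTransition.zero_of_nonpos (by linarith), sub_self]

theorem hasCompactSupport_plateau : HasCompactSupport fun x => (plateau x : ℂ) := by
  refine HasCompactSupport.intro (isCompact_Icc (a := (-2 : ℝ)) (b := 1)) fun x hx => ?_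
  rw [Set.mem_Icc, not_and_or, not_le, not_le] at hx
  rcases hx with hx | hx
  · rw [plateau_eq_zero_of_le hx.le, Complex.ofReal_zero]
  · rw [plateau_eq_zero_of_ge hx.le, Complex.ofReal_zero]

theorem hasCompactSupport_stepDiff : HasCompactSupport fun x => (stepDiff x : ℂ) := by
  refine HasCompactSupport.intro (isCompact_Icc (a := (0 : ℝ)) (b := 2)) fun x hx => ?_
  rw [Set.mem_Icc, not_and_or, not_le, not_le] at hx
  rcases hx with hx | hx
  · rw [stepDiff_eq_zero_of_le hx.le, Complex.ofReal_zero]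
  · rw [stepDiff_eq_zero_of_ge hx.le, Complex.ofReal_zero]

theorem contDiff_plateau : ContDiff ℝ (⊤ : ℕ∞) fun x => (plateau x : ℂ) := by
  refine Complex.ofRealCLM.contDiff.comp (ContDiff.mul ?_ ?_)
  · exact Real.smoothTransition.contDiff.comp (contDiff_id.add contDiff_const)
  · exact Real.smoothTransition.contDiff.comp (contDiff_const.sub contDiff_id)

theorem contDiff_stepDiff : ContDiff ℝ (⊤ : ℕ∞) fun x => (stepDiff x : ℂ) := by
  refine Complex.ofRealCLM.contDiff.comp (ContDiff.sub ?_ ?_)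
  · exact Real.smoothTransition.contDiff.comp (contDiff_const.sub contDiff_id)
  · exact Real.smoothTransition.contDiff.comp (contDiff_const.sub (contDiff_id.div_const 2))

/-! ### Coefficient bounds and the case `L(lam) = 0` -/

theorem nonneg_of_supNorm_le {lam : ℕ → ℝ} {a : ℕ → ℂ} (ha : a ∈ DInfty lam) {M : ℝ}
    (hM : supNorm lam a ≤ M) : 0 ≤ M :=
  (norm_nonneg _).trans (norm_limitFun_le ha hM (s := 1) (by simp [halfPlane]))

/-- The coefficients of a series in `D_∞(lam)` are controlled by its norm. -/
theorem exists_norm_coeff_le : ∃ C : ℝ, 0 ≤ C ∧ ∀ lam : ℕ → ℝ, IsFrequency lam →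
    ∀ a ∈ DInfty lam, ∀ M : ℝ, supNorm lam a ≤ M → ∀ n, ‖a n‖ ≤ C * M := by
  obtain ⟨C, hC, H⟩ := exists_multiplier_bound hasCompactSupport_plateau contDiff_plateau
  refine ⟨C, hC, fun lam hlam a ha M hM n => ?_⟩
  -- The plateau vanishes from `1` on and up to `-2`, so gaps of `h` above and `2 * h` below leave
  -- only the `n`-th term.
  obtain ⟨h, hh, h1, h2⟩ : ∃ h : ℝ, 0 < h ∧ (∀ m, n < m → h ≤ lam m - lam n) ∧
      ∀ m, m < n → 2 * h ≤ lam n - lam m := by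
    have hup : ∀ m, n < m → lam (n + 1) - lam n ≤ lam m - lam n := fun m hm =>
      sub_le_sub_right (hlam.strictMono.monotone hm) _
    have hpos : 0 < lam (n + 1) - lam n := sub_pos.2 (hlam.strictMono n.lt_succ_self)
    rcases n with _ | k
    · exact ⟨_, hpos, hup, fun m hm => absurd hm (Nat.not_lt_zero m)⟩
    · have hk : 0 < lam (k + 1) - lam k := sub_pos.2 (hlam.strictMono k.lt_succ_self)
      refine ⟨min (lam (k + 1 + 1) - lam (k + 1)) ((lam (k + 1) - lam k) / 2),
        lt_min hpos (by positivity), fun m hm => (min_le_left _ _).trans (hup m hm), fun m hm => ?_⟩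
      have := min_le_right (lam (k + 1 + 1) - lam (k + 1)) ((lam (k + 1) - lam k) / 2)
      have := hlam.strictMono.monotone (Nat.lt_succ_iff.1 hm)
      linarith
  have hzero : ∀ m, n < m → plateau ((lam m - lam n) / h) = 0 := fun m hm =>
    plateau_eq_zero_of_ge ((one_le_div hh).2 (h1 m hm))
  have key : ∀ σ : ℝ, 0 < σ → ‖a n‖ * Real.exp (-lam n * σ) ≤ C * M := by
    intro σ hσ
    have := H lam hlam a ha M hM (lam n) h hh σ (by simpa using hσ) (n + 1)
      (fun m hm => by rw [hzero m hm, Complex.ofReal_zero])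
    rw [Finset.sum_range_succ, Finset.sum_eq_zero, zero_add, sub_self, zero_div,
      plateau_eq_one (by norm_num) le_rfl, Complex.ofReal_one, mul_one, norm_mul,
      norm_exp_neg_ofReal_mul] at this
    · simpa using this
    · intro m hm
      rw [plateau_eq_zero_of_le, Complex.ofReal_zero, mul_zero]
      rw [div_le_iff₀ hh]
      linarith [h2 m (Finset.mem_range.1 hm)]
  have hlim : Tendsto (fun σ : ℝ => ‖a n‖ * Real.exp (-lam n * σ)) (𝓝[>] 0) (𝓝 ‖a n‖) := by
    have : Continuous fun σ : ℝ => ‖a n‖ * Real.exp (-lam n * σ) := by fun_prop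
    simpa using (this.tendsto 0).mono_left nhdsWithin_le_nhds
  exact le_of_tendsto hlim (eventually_mem_nhdsWithin.mono key)

/-- On each half plane `[Re > ε]` the series of a ball of `D_∞(lam)` converge uniformly, at a
common rate. -/
def UniformTails (lam : ℕ → ℝ) : Prop :=
  ∀ M ε η : ℝ, 0 < ε → 0 < η → ∃ N₀ : ℕ, ∀ a ∈ DInfty lam, supNorm lam a ≤ M →
    ∀ N, N₀ ≤ N → ∀ s : ℂ, ε < s.re → ‖partialSum lam a N s - partialSum lam a N₀ s‖ ≤ η

theorem norm_partialSum_sub_le {lam : ℕ → ℝ} (hlam : IsFrequency lam) (a : ℕ → ℂ) {ε : ℝ} {s : ℂ}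
    (hs : ε < s.re) {N₀ N : ℕ} (hN : N₀ ≤ N) :
    ‖partialSum lam a N s - partialSum lam a N₀ s‖ ≤
      ∑ n ∈ Finset.Ico N₀ N, ‖a n‖ * Real.exp (-lam n * ε) := by
  rw [partialSum, partialSum, ← Finset.sum_Ico_eq_sub _ hN]
  refine norm_sum_le_of_le _ fun n _ => ?_
  rw [norm_mul, norm_exp_neg_ofReal_mul]
  refine mul_le_mul_of_nonneg_left (Real.exp_le_exp.2 ?_) (norm_nonneg _)
  nlinarith [hlam.nonneg n]

/-- Eventually `log (n + 1) < (ε / 2) * lam n`, hence `exp (-lam n * ε) ≤ (n + 1)⁻²`. -/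
theorem summable_exp_of_bohrL_eq_zero {lam : ℕ → ℝ} (hlam : IsFrequency lam) (h : bohrL lam = 0)
    {ε : ℝ} (hε : 0 < ε) : Summable fun n => Real.exp (-lam n * ε) := by
  have h1 : ∀ᶠ n : ℕ in atTop, ((Real.log ((n : ℝ) + 1) / lam n : ℝ) : EReal) < (ε / 2 : ℝ) := by
    refine eventually_lt_of_limsup_lt ?_
    change bohrL lam < _
    rw [h]
    exact_mod_cast half_pos hε
  have h2 : Summable fun n : ℕ => 1 / ((n : ℝ) + 1) ^ 2 := by
    have := (summable_nat_add_iff 1).2 (Real.summable_one_div_nat_pow.2 one_lt_two)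
    simpa using this
  refine Summable.of_norm_bounded_eventually_nat h2 ?_
  filter_upwards [h1, hlam.tendsto.eventually_gt_atTop 0] with n hn hpos
  rw [EReal.coe_lt_coe_iff, div_lt_iff₀ hpos] at hn
  rw [Real.norm_eq_abs, abs_of_pos (Real.exp_pos _), one_div]
  have h3 : (0 : ℝ) < (n : ℝ) + 1 := by positivity
  rw [← Real.exp_log (pow_pos h3 2), ← Real.exp_neg, Real.log_pow]
  refine Real.exp_le_exp.2 ?_
  push_cast
  linarith

theorem uniformTails_of_bohrL_eq_zero {lam : ℕ → ℝ} (hlam : IsFrequency lam)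
    (h : bohrL lam = 0) : UniformTails lam := by
  intro M ε η hε hη
  obtain ⟨C, hC, hcoef⟩ := exists_norm_coeff_le
  have hsum := (summable_exp_of_bohrL_eq_zero hlam h hε).mul_left (C * M)
  obtain ⟨N₀, hN₀⟩ := (tendsto_sum_nat_add fun n => C * M * Real.exp (-lam n * ε)).eventually
    (gt_mem_nhds hη) |>.exists
  refine ⟨N₀, fun a ha hM N hN s hs => (norm_partialSum_sub_le hlam a hs hN).trans ?_⟩
  have hCM : 0 ≤ C * M := mul_nonneg hC (nonneg_of_supNorm_le ha hM)
  refine le_trans ?_ hN₀.le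
  rw [Finset.sum_Ico_eq_sum_range]
  refine le_trans (Finset.sum_le_sum fun n _ =>
    mul_le_mul_of_nonneg_right (hcoef lam hlam a ha M hM (N₀ + n)) (Real.exp_nonneg _)) ?_
  simp_rw [add_comm N₀]
  exact ((summable_nat_add_iff N₀).2 hsum).sum_le_tsum _ fun n _ =>
    mul_nonneg hCM (Real.exp_nonneg _)

/-! ### Landau's condition -/

/-- A smooth step of width `h` acts as the sharp cut-off because no frequency lies inside it. It
telescopes into `J` dilates of `stepDiff` and a step of width `h * 2 ^ J`. As this width is at least
`lam N`, the last step agrees with a plateau on all the frequencies, which are non-negative. Each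
piece costs a constant. -/
theorem norm_partialSum_succ_le_of_dyadic : ∃ C : ℝ, 0 ≤ C ∧ ∀ lam : ℕ → ℝ, IsFrequency lam →
    ∀ a ∈ DInfty lam, ∀ M : ℝ, supNorm lam a ≤ M → ∀ (N J : ℕ) (h : ℝ), 0 < h →
    h ≤ lam (N + 1) - lam N → lam N ≤ h * 2 ^ J → ∀ s : ℂ, 0 < s.re →
    ‖partialSum lam a (N + 1) s‖ ≤ C * (J + 1) * M := by
  obtain ⟨C₁, hC₁, H₁⟩ := exists_multiplier_bound hasCompactSupport_plateau contDiff_plateau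
  obtain ⟨C₂, hC₂, H₂⟩ := exists_multiplier_bound hasCompactSupport_stepDiff contDiff_stepDiff
  refine ⟨C₁ + C₂, by positivity, ?_⟩
  intro lam hlam a ha M hM N J h hh hgap hJ s hs
  have hM0 := nonneg_of_supNorm_le ha hM
  obtain ⟨R, hR⟩ := eventually_atTop.1
    (hlam.tendsto.eventually_ge_atTop (lam N + 2 * (h * 2 ^ J)))
  set N' := max R (N + 1) with hN'
  have hfar : ∀ n, N' ≤ n → ∀ j ≤ J, 2 ≤ (lam n - lam N) / (h * 2 ^ j) := by
    intro n hn j hj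
    rw [le_div_iff₀ (by positivity)]
    have h1 := hR n ((le_max_left _ _).trans hn)
    have h2 : h * (2 : ℝ) ^ j ≤ h * 2 ^ J := by
      gcongr
      norm_num
    linarith
  have hdecomp : ∀ n, (Real.smoothTransition (1 - (lam n - lam N) / h) : ℂ) =
      ∑ j ∈ Finset.range J, (stepDiff ((lam n - lam N) / (h * 2 ^ j)) : ℂ) +
        (plateau ((lam n - lam N) / (h * 2 ^ J)) : ℂ) := by
    intro n
    have hpl : -1 ≤ (lam n - lam N) / (h * 2 ^ J) := by
      rw [le_div_iff₀ (by positivity)]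
      linarith [hlam.nonneg n]
    rw [plateau_eq_step hpl]
    rw [← Complex.ofReal_sum, ← Complex.ofReal_add, Complex.ofReal_inj]
    have : ∀ j, stepDiff ((lam n - lam N) / (h * 2 ^ j)) =
        Real.smoothTransition (1 - (lam n - lam N) / (h * 2 ^ j)) -
        Real.smoothTransition (1 - (lam n - lam N) / (h * 2 ^ (j + 1))) := by
      intro j
      rw [stepDiff, div_div, pow_succ, mul_assoc]
    simp_rw [this]
    rw [Finset.sum_range_sub' fun j => Real.smoothTransition (1 - (lam n - lam N) / (h * 2 ^ j))]
    simp
  have hsum : partialSum lam a (N + 1) s = ∑ n ∈ Finset.range N',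
      a n * Complex.exp (-(lam n : ℂ) * s) *
        (Real.smoothTransition (1 - (lam n - lam N) / h) : ℂ) := by
    rw [← Finset.sum_subset (Finset.range_mono (le_max_right R (N + 1)))]
    · refine Finset.sum_congr rfl fun n hn => ?_
      have : (lam n - lam N) / h ≤ 0 := div_nonpos_of_nonpos_of_nonneg
        (sub_nonpos.2 (hlam.strictMono.monotone (Nat.lt_succ_iff.1 (Finset.mem_range.1 hn)))) hh.le
      rw [Real.smoothTransition.one_of_one_le (by linarith), Complex.ofReal_one, mul_one]
    · intro n _ hn
      have h1 : N + 1 ≤ n := by simpa using hn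
      have : 1 ≤ (lam n - lam N) / h := by
        rw [one_le_div hh]
        linarith [hlam.strictMono.monotone h1]
      rw [Real.smoothTransition.zero_of_nonpos (by linarith), Complex.ofReal_zero, mul_zero]
  have hsplit : partialSum lam a (N + 1) s =
      ∑ j ∈ Finset.range J, ∑ n ∈ Finset.range N', a n * Complex.exp (-(lam n : ℂ) * s) *
        (stepDiff ((lam n - lam N) / (h * 2 ^ j)) : ℂ) +
      ∑ n ∈ Finset.range N', a n * Complex.exp (-(lam n : ℂ) * s) *
        (plateau ((lam n - lam N) / (h * 2 ^ J)) : ℂ) := by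
    rw [hsum, Finset.sum_comm, ← Finset.sum_add_distrib]
    refine Finset.sum_congr rfl fun n _ => ?_
    rw [hdecomp, mul_add, Finset.mul_sum]
  have hstep : ∀ j ∈ Finset.range J, ‖∑ n ∈ Finset.range N', a n *
      Complex.exp (-(lam n : ℂ) * s) * (stepDiff ((lam n - lam N) / (h * 2 ^ j)) : ℂ)‖ ≤ C₂ * M :=
    fun j hj => H₂ lam hlam a ha M hM (lam N) (h * 2 ^ j) (by positivity) s hs N' fun n hn => by
      rw [stepDiff_eq_zero_of_ge (hfar n hn j (Finset.mem_range.1 hj).le), Complex.ofReal_zero]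
  have hpl := H₁ lam hlam a ha M hM (lam N) (h * 2 ^ J) (by positivity) s hs N' fun n hn => by
      rw [plateau_eq_zero_of_ge (one_le_two.trans (hfar n hn J le_rfl)), Complex.ofReal_zero]
  rw [hsplit]
  refine (norm_add_le _ _).trans ((add_le_add (norm_sum_le_of_le _ hstep) hpl).trans ?_)
  rw [Finset.sum_const, Finset.card_range, nsmul_eq_mul]
  have h1 : 0 ≤ C₂ * M := by positivity
  have h2 : 0 ≤ C₁ * M * J := by positivity
  linarith

/-- Under Landau's condition the partial sums grow subexponentially in the frequency. -/
theorem LandauCondition.exists_norm_partialSum_le {lam : ℕ → ℝ} (hlam : IsFrequency lam)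
    (hLC : LandauCondition lam) {δ : ℝ} (hδ : 0 < δ) : ∃ K : ℝ, 0 ≤ K ∧
    ∀ a ∈ DInfty lam, ∀ M : ℝ, supNorm lam a ≤ M → ∀ (N : ℕ) (s : ℂ), 0 < s.re →
    ‖partialSum lam a (N + 1) s‖ ≤ K * M * Real.exp (δ * lam N) := by
  obtain ⟨C, hC, H⟩ := norm_partialSum_succ_le_of_dyadic
  obtain ⟨c, hc, hgap⟩ := hLC δ hδ
  set d := min 1 c with hd
  have hd0 : 0 < d := lt_min one_pos hc
  have hlogd : Real.log d ≤ 0 := Real.log_nonpos hd0.le (min_le_left _ _)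
  have hlog2 : 0 < Real.log 2 := Real.log_pos one_lt_two
  -- Chosen so that `logb 2 ((lam N + 1) / h) ≤ A * E`: here `log (lam N + 1) ≤ lam N ≤ E / δ`,
  -- `-log h = E - log d`, and `-log d ≤ -E * log d` as `E ≥ 1`.
  set A := (1 / δ + 1 - Real.log d) / Real.log 2 with hA
  have hA0 : 0 ≤ A := div_nonneg (by have := one_div_pos.2 hδ; linarith) hlog2.le
  refine ⟨C * (A + 2), by positivity, fun a ha M hM N s hs => ?_⟩
  have hM0 := nonneg_of_supNorm_le ha hM
  have hl := hlam.nonneg N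
  set E := Real.exp (δ * lam N) with hE
  have hE1 : 1 ≤ E := Real.one_le_exp (by positivity)
  have hlE : lam N ≤ 1 / δ * E := by
    have := Real.add_one_le_exp (δ * lam N)
    rw [one_div, ← div_eq_inv_mul, le_div_iff₀ hδ]
    linarith
  set h := d * Real.exp (-E) with hh
  have hh0 : 0 < h := by positivity
  have hh1 : h ≤ lam (N + 1) - lam N :=
    le_trans (mul_le_mul_of_nonneg_right (min_le_right _ _) (Real.exp_nonneg _)) (hgap N)
  have hhle : h ≤ 1 := mul_le_one₀ (min_le_left _ _) (Real.exp_nonneg _)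
    (Real.exp_le_one_iff.2 (by linarith))
  have hratio : 1 ≤ (lam N + 1) / h := (one_le_div hh0).2 (by linarith)
  set J := ⌈Real.logb 2 ((lam N + 1) / h)⌉₊ with hJ
  have hJ1 : lam N ≤ h * 2 ^ J := by
    have h1 : (lam N + 1) / h ≤ 2 ^ J := by
      rw [← Real.rpow_natCast, ← Real.logb_le_iff_le_rpow one_lt_two (by positivity)]
      exact Nat.le_ceil _
    rw [div_le_iff₀ hh0] at h1
    linarith
  have hJ2 : (J : ℝ) ≤ A * E + 1 := by
    refine (Nat.ceil_lt_add_one (Real.logb_nonneg one_lt_two hratio)).le.trans ?_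
    gcongr
    rw [Real.logb, hA, div_mul_eq_mul_div]
    gcongr
    rw [Real.log_div (by positivity) hh0.ne', hh, Real.log_mul hd0.ne' (Real.exp_ne_zero _),
      Real.log_exp]
    have h1 := Real.log_le_sub_one_of_pos (show 0 < lam N + 1 by positivity)
    nlinarith
  refine (H lam hlam a ha M hM N J h hh0 hh1 hJ1 s hs).trans ?_
  have h2 : (J : ℝ) + 1 ≤ (A + 2) * E := by linarith
  calc C * (J + 1) * M ≤ C * ((A + 2) * E) * M := by gcongr
    _ = C * (A + 2) * M * E := by ring

theorem uniformTails_of_landauCondition {lam : ℕ → ℝ} (hlam : IsFrequency lam)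
    (hLC : LandauCondition lam) : UniformTails lam := by
  intro M ε η hε hη
  -- Moving left by `2 * δ = ε / 2` stays in `[Re > 0]`. The shift gives weights `q n ^ 2` against
  -- partial sums of size `(q n)⁻¹`, which leaves a telescoping series in `q`.
  set δ := ε / 4 with hδ
  have hδ0 : 0 < δ := by positivity
  obtain ⟨K, hK, H⟩ := hLC.exists_norm_partialSum_le hlam hδ0
  have htend : Tendsto (fun n => 4 * (K * M) * Real.exp (-(δ * lam n))) atTop (𝓝 0) := by
    have := (Real.tendsto_exp_neg_atTop_nhds_zero.comp
      (hlam.tendsto.const_mul_atTop hδ0)).const_mul (4 * (K * M))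
    simpa using this
  obtain ⟨N₀, hN₀⟩ := (htend.eventually (gt_mem_nhds hη)).exists
  refine ⟨N₀, fun a ha hM N hN s hs => le_trans ?_ hN₀.le⟩
  have hKM : 0 ≤ K * M := mul_nonneg hK (nonneg_of_supNorm_le ha hM)
  set s₀ : ℂ := s - ((2 * δ : ℝ) : ℂ) with hs₀
  have hs₀re : 0 < s₀.re := by
    simp only [hs₀, Complex.sub_re, Complex.ofReal_re]
    linarith
  set q : ℕ → ℝ := fun n => Real.exp (-(δ * lam n)) with hq
  have hq0 : ∀ n, 0 < q n := fun n => Real.exp_pos _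
  have hqanti : ∀ n, q (n + 1) ≤ q n := fun n => Real.exp_le_exp.2 (by
    nlinarith [hlam.strictMono.monotone n.le_succ])
  have hqinv : ∀ n, Real.exp (δ * lam n) = (q n)⁻¹ := fun n => by
    rw [hq, ← Real.exp_neg, neg_neg]
  have hv : ∀ n, Complex.exp (-(lam n : ℂ) * ((2 * δ : ℝ) : ℂ)) = ((q n ^ 2 : ℝ) : ℂ) := by
    intro n
    rw [hq, ← Real.exp_nat_mul, Complex.ofReal_exp]
    push_cast
    ring_nf
  have hU : ∀ n, ‖partialSum lam a (n + 1) s₀‖ ≤ K * M * (q n)⁻¹ := fun n => by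
    rw [← hqinv]
    exact H a ha M hM n s₀ hs₀re
  -- The sum of the first `n` terms ends at index `n - 1`, and `(q (n - 1))⁻¹ ≤ (q n)⁻¹`.
  have hU' : ∀ n, ‖partialSum lam a n s₀ * ((q n ^ 2 : ℝ) : ℂ)‖ ≤ K * M * q n := by
    intro n
    rw [norm_mul, Complex.norm_of_nonneg (sq_nonneg _)]
    have h1 : ‖partialSum lam a n s₀‖ ≤ K * M * (q n)⁻¹ := by
      rcases n with _ | n
      · simp only [partialSum, Finset.range_zero, Finset.sum_empty, norm_zero]
        exact mul_nonneg hKM (inv_nonneg.2 (hq0 0).le)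
      · refine (hU n).trans (mul_le_mul_of_nonneg_left ?_ hKM)
        exact inv_anti₀ (hq0 _) (hqanti n)
    refine (mul_le_mul_of_nonneg_right h1 (sq_nonneg _)).trans (le_of_eq ?_)
    have := (hq0 n).ne'
    field_simp
  have hterm : ∀ n, ‖partialSum lam a (n + 1) s₀ * (((q n ^ 2 : ℝ) : ℂ) - ((q (n + 1) ^ 2 : ℝ) : ℂ))‖
      ≤ 2 * (K * M) * (q n - q (n + 1)) := by
    intro n
    have h0 : 0 ≤ q n ^ 2 - q (n + 1) ^ 2 := by nlinarith [hqanti n, hq0 n, hq0 (n + 1)]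
    rw [norm_mul, ← Complex.ofReal_sub, Complex.norm_of_nonneg h0]
    refine (mul_le_mul_of_nonneg_right (hU n) h0).trans ?_
    have h1 : (q n)⁻¹ * (q n ^ 2 - q (n + 1) ^ 2) ≤ 2 * (q n - q (n + 1)) := by
      rw [inv_mul_le_iff₀ (hq0 n)]
      nlinarith [hqanti n]
    nlinarith [mul_le_mul_of_nonneg_left h1 hKM]
  have hparts : ∀ m, partialSum lam a m s = partialSum lam a m s₀ * ((q m ^ 2 : ℝ) : ℂ) +
      ∑ n ∈ Finset.range m, partialSum lam a (n + 1) s₀ *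
        (((q n ^ 2 : ℝ) : ℂ) - ((q (n + 1) ^ 2 : ℝ) : ℂ)) := by
    intro m
    have : s = s₀ + ((2 * δ : ℝ) : ℂ) := by rw [hs₀]; ring
    rw [this, partialSum_add, sum_range_mul_eq_by_parts]
    simp only [hv]
    rfl
  have hqN : q N ≤ q N₀ := antitone_nat_of_succ_le hqanti hN
  rw [hparts N, hparts N₀, add_sub_add_comm, ← Finset.sum_Ico_eq_sub _ hN]
  refine (norm_add_le _ _).trans ?_
  have h1 := (norm_sub_le (partialSum lam a N s₀ * ((q N ^ 2 : ℝ) : ℂ))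
    (partialSum lam a N₀ s₀ * ((q N₀ ^ 2 : ℝ) : ℂ))).trans (add_le_add (hU' N) (hU' N₀))
  have h2 := norm_sum_le_of_le (Finset.Ico N₀ N) fun n _ => hterm n
  have h3 : ∑ n ∈ Finset.Ico N₀ N, (q n - q (n + 1)) = q N₀ - q N := by
    rw [Finset.sum_Ico_eq_sub _ hN, Finset.sum_range_sub', Finset.sum_range_sub']
    ring
  rw [← Finset.mul_sum, h3] at h2
  have h4 := mul_le_mul_of_nonneg_left hqN hKM
  have h5 := mul_nonneg hKM (hq0 N).le
  have h6 : Real.exp (-(δ * lam N₀)) = q N₀ := rfl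
  rw [h6]
  linarith

/-! ### From uniform tails to Montel's theorem -/

/-- Montel's theorem in `D_∞(lam)`, when the series of each ball converge at a common rate. -/
theorem UniformTails.exists_subseq {lam : ℕ → ℝ} (hlam : IsFrequency lam)
    (htail : UniformTails lam) (D : ℕ → ℕ → ℂ) (hD : ∀ j, D j ∈ DInfty lam) {M : ℝ}
    (hM : ∀ j, supNorm lam (D j) ≤ M) :
    ∃ φ : ℕ → ℕ, StrictMono φ ∧ ∃ a ∈ DInfty lam,
      (∀ n : ℕ, Tendsto (fun k => D (φ k) n) atTop (𝓝 (a n))) ∧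
      ∀ ε : ℝ, 0 < ε → TendstoUniformlyOn (fun k s => limitFun lam (D (φ k)) s)
        (limitFun lam a) atTop (halfPlane ε) := by
  obtain ⟨C, hC, hcoef⟩ := exists_norm_coeff_le
  have hcomp : IsCompact (Set.univ.pi fun _ : ℕ => Metric.closedBall (0 : ℂ) (C * M)) :=
    isCompact_univ_pi fun _ => isCompact_closedBall _ _
  obtain ⟨a, -, φ, hφ, hlim⟩ := hcomp.tendsto_subseq (x := D) fun j n _ => by
    simpa using hcoef lam hlam (D j) (hD j) M (hM j) n
  rw [tendsto_pi_nhds] at hlim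
  have hpart : ∀ N s, Tendsto (fun k => partialSum lam (D (φ k)) N s) atTop
      (𝓝 (partialSum lam a N s)) := fun N s =>
    tendsto_finsetSum _ fun n _ => (hlim n).mul_const _
  -- The tail bound survives the coefficientwise limit because it only involves finite sums.
  have htail' : ∀ ε η : ℝ, 0 < ε → 0 < η → ∃ N₀ : ℕ, ∀ N, N₀ ≤ N → ∀ s : ℂ, ε < s.re →
      (∀ k, ‖partialSum lam (D (φ k)) N s - partialSum lam (D (φ k)) N₀ s‖ ≤ η) ∧
      ‖partialSum lam a N s - partialSum lam a N₀ s‖ ≤ η := by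
    intro ε η hε hη
    obtain ⟨N₀, hN₀⟩ := htail M ε η hε hη
    refine ⟨N₀, fun N hN s hs => ?_⟩
    have h1 := fun k => hN₀ (D (φ k)) (hD _) (hM _) N hN s hs
    exact ⟨h1, le_of_tendsto ((hpart N s).sub (hpart N₀ s)).norm (Eventually.of_forall h1)⟩
  have hconv : ∀ s ∈ halfPlane 0, ConvergesAt lam a s := by
    intro s hs
    have hs' : 0 < s.re := hs
    refine cauchySeq_tendsto_of_complete (Metric.cauchySeq_iff'.2 fun η hη => ?_)
    obtain ⟨N₀, hN₀⟩ := htail' (s.re / 2) (η / 2) (half_pos hs') (half_pos hη)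
    refine ⟨N₀, fun N hN => ?_⟩
    rw [dist_eq_norm]
    exact ((hN₀ N hN s (half_lt_self hs')).2).trans_lt (half_lt_self hη)
  have hunif : ∀ ε : ℝ, 0 < ε → TendstoUniformlyOn (fun k s => limitFun lam (D (φ k)) s)
      (limitFun lam a) atTop (halfPlane ε) := by
    intro ε hε
    rw [Metric.tendstoUniformlyOn_iff]
    intro η hη
    obtain ⟨N₀, hN₀⟩ := htail' ε (η / 4) hε (by positivity)
    have hsum : Tendsto (fun k => ∑ n ∈ Finset.range N₀, ‖a n - D (φ k) n‖) atTop (𝓝 0) := by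
      have := tendsto_finsetSum (Finset.range N₀) fun n _ => ((hlim n).const_sub (a n)).norm
      simpa using this
    filter_upwards [hsum.eventually (gt_mem_nhds (show 0 < η / 4 by positivity))] with k hk s hs
    have hs0 : s ∈ halfPlane 0 := hε.trans hs
    have h1 : ‖limitFun lam a s - partialSum lam a N₀ s‖ ≤ η / 4 :=
      le_of_tendsto ((tendsto_limitFun (hconv s hs0)).sub_const _).norm
        ((eventually_ge_atTop N₀).mono fun N hN => (hN₀ N hN s hs).2)
    have h2 : ‖limitFun lam (D (φ k)) s - partialSum lam (D (φ k)) N₀ s‖ ≤ η / 4 :=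
      le_of_tendsto ((tendsto_limitFun ((hD (φ k)).1 s hs0)).sub_const _).norm
        ((eventually_ge_atTop N₀).mono fun N hN => (hN₀ N hN s hs).1 k)
    have h3 : ‖partialSum lam a N₀ s - partialSum lam (D (φ k)) N₀ s‖ < η / 4 := by
      refine lt_of_le_of_lt ?_ hk
      rw [partialSum, partialSum, ← Finset.sum_sub_distrib]
      refine norm_sum_le_of_le _ fun n _ => ?_
      rw [← sub_mul, norm_mul]
      exact mul_le_of_le_one_right (norm_nonneg _)
        (norm_exp_neg_ofReal_mul_le_one (hlam.nonneg n) (le_of_lt hs0))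
    rw [dist_eq_norm]
    calc _ = ‖(limitFun lam a s - partialSum lam a N₀ s) +
          (partialSum lam a N₀ s - partialSum lam (D (φ k)) N₀ s) -
          (limitFun lam (D (φ k)) s - partialSum lam (D (φ k)) N₀ s)‖ := by congr 1; ring
      _ ≤ _ := (norm_sub_le _ _).trans (add_le_add_left (norm_add_le _ _) _)
      _ < η := by linarith
  refine ⟨φ, hφ, a, ⟨hconv, M, ?_⟩, hlim, hunif⟩
  rintro _ ⟨s, hs, rfl⟩
  have hs' : 0 < s.re := hs
  have h1 := (hunif (s.re / 2) (half_pos hs')).tendsto_at (half_lt_self hs' : s.re / 2 < s.re)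
  exact le_of_tendsto h1.norm (Eventually.of_forall fun k => norm_limitFun_le (hD _) (hM _) hs)

/-! ### Riesz products and linearly independent frequencies -/

/-- The mean value of an exponential. -/
theorem tendsto_mean_exp (μ : ℝ) :
    Tendsto (fun T : ℝ => (T⁻¹ : ℂ) * ∫ t in (0 : ℝ)..T, Complex.exp (μ * Complex.I * t)) atTop
      (𝓝 (if μ = 0 then 1 else 0)) := by
  split_ifs with hμ
  · refine tendsto_const_nhds.congr' ?_
    filter_upwards [eventually_gt_atTop 0] with T hT
    have : (T : ℂ) ≠ 0 := by exact_mod_cast hT.ne'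
    simp [hμ, this]
  · have hc : (μ : ℂ) * Complex.I ≠ 0 := mul_ne_zero (by exact_mod_cast hμ) Complex.I_ne_zero
    refine squeeze_zero_norm' (a := fun T : ℝ => T⁻¹ * (2 / |μ|)) ?_ ?_
    · filter_upwards [eventually_gt_atTop 0] with T hT
      have h1 : ∀ x : ℝ, ‖Complex.exp (μ * Complex.I * x)‖ = 1 := fun x => by
        simp [Complex.norm_exp]
      rw [integral_exp_mul_complex hc, norm_mul, norm_div, norm_mul, Complex.norm_I, mul_one,
        norm_inv, Complex.norm_real, Complex.norm_real, Real.norm_eq_abs, Real.norm_eq_abs,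
        abs_of_pos hT]
      gcongr
      refine (norm_sub_le _ _).trans ?_
      rw [h1, h1]
      norm_num
    · simpa using tendsto_inv_atTop_zero.mul_const (2 / |μ|)

/-- The mean value of an almost periodic polynomial. -/
theorem tendsto_mean_sum_exp {ι : Type*} (S : Finset ι) (d : ι → ℂ) (μ : ι → ℝ) :
    Tendsto (fun T : ℝ => (T⁻¹ : ℂ) * ∫ t in (0 : ℝ)..T,
      ∑ i ∈ S, d i * Complex.exp (μ i * Complex.I * t)) atTop
      (𝓝 (∑ i ∈ S, if μ i = 0 then d i else 0)) := by
  have h := tendsto_finsetSum S fun i _ => (tendsto_mean_exp (μ i)).const_mul (d i)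
  simp only [mul_ite, mul_one, mul_zero] at h
  refine h.congr fun T => ?_
  rw [intervalIntegral.integral_finsetSum fun i _ =>
    Continuous.intervalIntegrable (by fun_prop) _ _, Finset.mul_sum]
  refine Finset.sum_congr rfl fun i _ => ?_
  rw [intervalIntegral.integral_const_mul]
  ring

/-- The coefficients of a factor of a Riesz product. -/
noncomputable def rieszCoeff (w : ℂ) (j : ℤ) : ℂ :=
  if j = 0 then 1 else if j = 1 then w / 2 else (starRingEnd ℂ) w / 2

theorem sum_rieszCoeff_mul_exp (w : ℂ) (x : ℝ) :
    ∑ j ∈ ({-1, 0, 1} : Finset ℤ), rieszCoeff w j * Complex.exp ((j * x : ℝ) * Complex.I) =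
      ((1 + (w * Complex.exp (x * Complex.I)).re : ℝ) : ℂ) := by
  have h : Complex.exp (-(x * Complex.I)) = (starRingEnd ℂ) (Complex.exp (x * Complex.I)) := by
    rw [← Complex.exp_conj]; simp
  rw [Finset.sum_insert (by decide), Finset.sum_insert (by decide), Finset.sum_singleton]
  push_cast
  rw [Complex.re_eq_add_conj]
  simp only [rieszCoeff, map_mul, ← h]
  norm_num
  ring

theorem int_eq_of_linearIndependent {ι : Type*} [Fintype ι] {μ : ι → ℝ}
    (hμ : LinearIndependent ℚ μ) {k l : ι → ℤ} (h : ∑ i, (k i : ℝ) * μ i = ∑ i, (l i : ℝ) * μ i) :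
    k = l := by
  funext i
  have := Fintype.linearIndependent_iff.1 hμ (fun i => (k i : ℚ) - l i) (by
    simp only [sub_smul, Finset.sum_sub_distrib, Rat.smul_def, Rat.cast_intCast]
    rw [h, sub_self]) i
  exact_mod_cast sub_eq_zero.1 this

/-- A weak form of Kronecker's theorem: trigonometric polynomials whose frequencies are linearly
independent over the rationals have their coefficient sum controlled by their maximum. -/
theorem sum_norm_le_of_linearIndependent {ι : Type*} [Fintype ι] {μ : ι → ℝ}
    (hμ : LinearIndependent ℚ μ) (c : ι → ℂ) {B : ℝ}
    (hB : ∀ t : ℝ, ‖∑ n, c n * Complex.exp (-(μ n : ℂ) * (t * Complex.I))‖ ≤ B) :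
    ∑ n, ‖c n‖ ≤ 2 * B := by
  classical
  -- Phases with `c n * w n = ‖c n‖`; division by zero makes `w n = 0` when `c n = 0`.
  set w : ι → ℂ := fun n => (starRingEnd ℂ) (c n) / ‖c n‖ with hw
  have hwn : ∀ n, ‖w n‖ ≤ 1 := fun n => by
    simpa [hw] using div_self_le_one ‖c n‖
  have hcw : ∀ n, c n * w n = ‖c n‖ := by
    intro n
    by_cases h : c n = 0
    · simp [h]
    · have h' : (‖c n‖ : ℂ) ≠ 0 := by simpa using h
      rw [hw, mul_div_assoc', Complex.mul_conj, Complex.normSq_eq_norm_sq]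
      field_simp
      push_cast
      rfl
  -- The Riesz product is non-negative with mean `1`, so the mean of `R * P` is at most `B` in
  -- modulus. By independence, the only term of `R` that pairs with the `n`-th term of `P` has
  -- coefficient `w n / 2`, so this mean is `(∑ ‖c n‖) / 2`.
  set R : ℝ → ℝ := fun t => ∏ n, (1 + (w n * Complex.exp ((μ n * t : ℝ) * Complex.I)).re) with hR
  have hR0 : ∀ t, 0 ≤ R t := by
    refine fun t => Finset.prod_nonneg fun n _ => ?_
    have h1 := Complex.abs_re_le_norm (w n * Complex.exp ((μ n * t : ℝ) * Complex.I))
    rw [norm_mul, Complex.norm_exp_ofReal_mul_I, mul_one] at h1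
    linarith [neg_abs_le (w n * Complex.exp ((μ n * t : ℝ) * Complex.I)).re, hwn n]
  have hRc : Continuous R := by
    refine continuous_finsetProd _ fun n _ => ?_
    exact continuous_const.add (Complex.continuous_re.comp (by fun_prop))
  set E : Finset (ι → ℤ) := Fintype.piFinset fun _ => {-1, 0, 1} with hE
  set d : (ι → ℤ) → ℂ := fun k => ∏ n, rieszCoeff (w n) (k n) with hd
  set ν : (ι → ℤ) → ℝ := fun k => ∑ n, (k n : ℝ) * μ n with hν
  have hRexp : ∀ t, (R t : ℂ) = ∑ k ∈ E, d k * Complex.exp (ν k * Complex.I * t) := by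
    intro t
    simp only [hR, Complex.ofReal_prod, ← sum_rieszCoeff_mul_exp]
    rw [Finset.prod_univ_sum]
    refine Finset.sum_congr rfl fun k _ => ?_
    rw [Finset.prod_mul_distrib, ← Complex.exp_sum]
    congr 2
    simp only [hν, Complex.ofReal_sum, Finset.sum_mul]
    refine Finset.sum_congr rfl fun n _ => ?_
    push_cast
    ring
  set P : ℝ → ℂ := fun t => ∑ n, c n * Complex.exp (-(μ n : ℂ) * (t * Complex.I)) with hP
  have hPc : Continuous P := by fun_prop
  have hRP : ∀ t, (R t : ℂ) * P t = ∑ x ∈ E ×ˢ Finset.univ,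
      d x.1 * c x.2 * Complex.exp ((ν x.1 - μ x.2 : ℝ) * Complex.I * t) := by
    intro t
    rw [hRexp, hP, Finset.sum_mul_sum, Finset.sum_product]
    refine Finset.sum_congr rfl fun k _ => Finset.sum_congr rfl fun n _ => ?_
    rw [mul_mul_mul_comm, ← Complex.exp_add]
    congr 2
    push_cast
    ring
  have hmeanR := tendsto_mean_sum_exp E d ν
  have hval0 : ∑ k ∈ E, (if ν k = 0 then d k else 0) = 1 := by
    rw [Finset.sum_eq_single 0]
    · simp [hν, hd, rieszCoeff]
    · intro k _ hk
      refine if_neg fun h => hk (int_eq_of_linearIndependent hμ ?_)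
      simpa [hν] using h
    · intro h
      exact absurd (by simp [hE]) h
  have hmeanRP := tendsto_mean_sum_exp (E ×ˢ (Finset.univ : Finset ι))
    (fun x => d x.1 * c x.2) (fun x => ν x.1 - μ x.2)
  have hval1 : ∑ x ∈ E ×ˢ (Finset.univ : Finset ι),
      (if ν x.1 - μ x.2 = 0 then d x.1 * c x.2 else 0) = ((∑ n, ‖c n‖) / 2 : ℝ) := by
    rw [Finset.sum_product_right]
    push_cast
    rw [Finset.sum_div]
    refine Finset.sum_congr rfl fun m _ => ?_
    have hsingle : ν (Pi.single m 1) = μ m := by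
      simp [hν, Pi.single_apply]
    rw [Finset.sum_eq_single (Pi.single m 1)]
    · have : d (Pi.single m 1) = w m / 2 := by
        simp only [hd]
        rw [Finset.prod_eq_single m]
        · simp [rieszCoeff]
        · intro n _ hn
          simp [rieszCoeff, hn]
        · simp
      rw [if_pos (by rw [hsingle, sub_self]), this, ← hcw]
      ring
    · intro k _ hk
      refine if_neg fun h => hk (int_eq_of_linearIndependent hμ ?_)
      change ν k = ν (Pi.single m 1)
      rw [hsingle]
      exact sub_eq_zero.1 h
    · intro h
      refine absurd ?_ h
      rw [hE, Fintype.mem_piFinset]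
      intro n
      by_cases hn : n = m
      · subst hn; simp
      · simp [hn]
  rw [hval0] at hmeanR
  rw [hval1] at hmeanRP
  simp_rw [← hRexp] at hmeanR
  simp_rw [← hRP] at hmeanRP
  have hle := le_of_tendsto_of_tendsto hmeanRP.norm (hmeanR.norm.const_mul B) (by
    filter_upwards [eventually_gt_atTop 0] with T hT
    rw [norm_mul, norm_mul, mul_left_comm]
    refine mul_le_mul_of_nonneg_left ?_ (norm_nonneg _)
    have hint : 0 ≤ ∫ t in (0 : ℝ)..T, R t :=
      intervalIntegral.integral_nonneg hT.le fun t _ => hR0 t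
    rw [intervalIntegral.integral_ofReal, Complex.norm_of_nonneg hint,
      ← intervalIntegral.integral_const_mul]
    refine intervalIntegral.norm_integral_le_of_norm_le hT.le
      (Eventually.of_forall fun t _ => ?_) (Continuous.intervalIntegrable (by fun_prop) _ _)
    rw [norm_mul, Complex.norm_of_nonneg (hR0 t), mul_comm]
    exact mul_le_mul_of_nonneg_right (hB t) (hR0 t))
  rw [Complex.norm_of_nonneg (by positivity), norm_one, mul_one] at hle
  linarith

/-- For linearly independent frequencies, the series in `D_∞(lam)` have absolutely summable
coefficients. -/
theorem exists_sum_norm_coeff_le : ∃ C : ℝ, 0 ≤ C ∧ ∀ lam : ℕ → ℝ, IsFrequency lam →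
    LinearIndependent ℚ lam → ∀ a ∈ DInfty lam, ∀ M : ℝ, supNorm lam a ≤ M →
    ∀ N, ∑ n ∈ Finset.range N, ‖a n‖ ≤ C * M := by
  obtain ⟨C, hC, H⟩ := exists_multiplier_bound hasCompactSupport_plateau contDiff_plateau
  refine ⟨2 * C, by positivity, fun lam hlam hind a ha M hM N => ?_⟩
  -- With this width the plateau equals `1` at every frequency up to `lam N`; the `1` keeps `h`
  -- positive when `lam N = 0`.
  set h := lam N + 1 with hh
  have hh0 : 0 < h := by linarith [hlam.nonneg N]
  obtain ⟨R, hR⟩ := eventually_atTop.1 (hlam.tendsto.eventually_ge_atTop (lam N + h))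
  set N' := max R N with hN'
  have hfar : ∀ n, N' ≤ n → (plateau ((lam n - lam N) / h) : ℂ) = 0 := fun n hn => by
    rw [plateau_eq_zero_of_ge, Complex.ofReal_zero]
    rw [one_le_div hh0]
    linarith [hR n ((le_max_left _ _).trans hn)]
  have hone : ∀ n, n < N → (plateau ((lam n - lam N) / h) : ℂ) = 1 := fun n hn => by
    rw [plateau_eq_one, Complex.ofReal_one]
    · rw [le_div_iff₀ hh0]
      linarith [hlam.nonneg n]
    · exact div_nonpos_of_nonpos_of_nonneg (sub_nonpos.2 (hlam.strictMono.monotone hn.le)) hh0.le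
  -- The smoothed sum, unlike the sharp partial sum, is bounded by `C * M` on the whole line `[Re =
  -- σ]`, and it has the same first `N` coefficients.
  have key : ∀ σ : ℝ, 0 < σ →
      ∑ n ∈ Finset.range N, ‖a n‖ * Real.exp (-lam n * σ) ≤ 2 * C * M := by
    intro σ hσ
    set c : ℕ → ℂ := fun n =>
      a n * Complex.exp (-(lam n : ℂ) * σ) * (plateau ((lam n - lam N) / h) : ℂ) with hc
    have h1 : ∀ t : ℝ, ‖∑ n : Fin N', c n * Complex.exp (-(lam n : ℂ) * (t * Complex.I))‖ ≤
        C * M := by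
      intro t
      rw [Fin.sum_univ_eq_sum_range fun n => c n * Complex.exp (-(lam n : ℂ) * (t * Complex.I))]
      have h2 := H lam hlam a ha M hM (lam N) h hh0 (σ + t * Complex.I) (by simpa using hσ) N' hfar
      convert h2 using 3 with n _
      rw [hc, mul_add, Complex.exp_add]
      ring
    have h3 := sum_norm_le_of_linearIndependent (hind.comp _ Fin.val_injective) (fun n => c n) h1
    rw [Fin.sum_univ_eq_sum_range fun n => ‖c n‖, ← mul_assoc] at h3
    refine le_trans ?_ h3
    refine le_trans (le_of_eq ?_) (Finset.sum_le_sum_of_subset_of_nonneg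
      (Finset.range_mono (le_max_right R N)) fun n _ _ => norm_nonneg _)
    refine Finset.sum_congr rfl fun n hn => ?_
    simp only [hc]
    rw [hone n (Finset.mem_range.1 hn), mul_one, norm_mul, norm_exp_neg_ofReal_mul,
      Complex.ofReal_re]
  have hlim : Tendsto (fun σ : ℝ => ∑ n ∈ Finset.range N, ‖a n‖ * Real.exp (-lam n * σ)) (𝓝[>] 0)
      (𝓝 (∑ n ∈ Finset.range N, ‖a n‖)) := by
    have : Continuous fun σ : ℝ => ∑ n ∈ Finset.range N, ‖a n‖ * Real.exp (-lam n * σ) := by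
      fun_prop
    simpa using (this.tendsto 0).mono_left nhdsWithin_le_nhds
  exact le_of_tendsto hlim (eventually_mem_nhdsWithin.mono key)

/-- The coefficients are absolutely summable with a common bound, so a tail is at most `exp (-ε *
lam N₀)` times that bound. -/
theorem uniformTails_of_linearIndependent {lam : ℕ → ℝ} (hlam : IsFrequency lam)
    (hind : LinearIndependent ℚ lam) : UniformTails lam := by
  intro M ε η hε hη
  obtain ⟨C, hC, H⟩ := exists_sum_norm_coeff_le
  have htend : Tendsto (fun n => C * M * Real.exp (-(ε * lam n))) atTop (𝓝 0) := by
    have := (Real.tendsto_exp_neg_atTop_nhds_zero.comp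
      (hlam.tendsto.const_mul_atTop hε)).const_mul (C * M)
    simpa using this
  obtain ⟨N₀, hN₀⟩ := (htend.eventually (gt_mem_nhds hη)).exists
  refine ⟨N₀, fun a ha hM N hN s hs => (norm_partialSum_sub_le hlam a hs hN).trans ?_⟩
  refine le_trans ?_ hN₀.le
  refine le_trans ?_ (mul_le_mul_of_nonneg_right (H lam hlam hind a ha M hM N) (Real.exp_nonneg _))
  rw [Finset.sum_mul]
  refine le_trans (Finset.sum_le_sum fun n hn => mul_le_mul_of_nonneg_left
    (Real.exp_le_exp.2 ?_) (norm_nonneg _)) (Finset.sum_le_sum_of_subset_of_nonneg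
      (fun n hn => Finset.mem_range.2 (Finset.mem_Ico.1 hn).2) fun n _ _ => by positivity)
  nlinarith [hlam.strictMono.monotone (Finset.mem_Ico.1 hn).1]

end GenDirichlet

theorem theorem4p10 (lam : ℕ → ℝ) (hlam : GenDirichlet.IsFrequency lam)
    (hcond : GenDirichlet.LandauCondition lam ∨ GenDirichlet.bohrL lam = 0 ∨
      LinearIndependent ℚ lam)
    (D : ℕ → ℕ → ℂ) (hD : ∀ j, D j ∈ GenDirichlet.DInfty lam)
    (hbdd : ∃ M : ℝ, ∀ j, GenDirichlet.supNorm lam (D j) ≤ M) :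
    ∃ φ : ℕ → ℕ, StrictMono φ ∧
      ∃ a : ℕ → ℂ, a ∈ GenDirichlet.DInfty lam ∧
        (∀ n : ℕ, Tendsto (fun k => D (φ k) n) atTop (𝓝 (a n))) ∧
        ∀ ε : ℝ, 0 < ε →
          TendstoUniformlyOn (fun k s => GenDirichlet.limitFun lam (D (φ k)) s)
            (GenDirichlet.limitFun lam a) atTop (GenDirichlet.halfPlane ε) := by
  obtain ⟨M, hM⟩ := hbdd
  have htail : GenDirichlet.UniformTails lam := by
    rcases hcond with h | h | h
    · exact GenDirichlet.uniformTails_of_landauCondition hlam h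
    · exact GenDirichlet.uniformTails_of_bohrL_eq_zero hlam h
    · exact GenDirichlet.uniformTails_of_linearIndependent hlam h
  exact htail.exists_subseq hlam D hD hM
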